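/- **Proposition (Piecewise affine objective functions).** Let $d=d_1+\cdots+d_n$ and write $\xi=(\xi_1,\dots,\xi_n)\in\mathbb R^d=\mathbb R^{d_1}\times\cdots\times\mathbb R^{d_n}$, $\mathrm{pr}_k(\xi)=\xi_k$. Let each $\mathbb R^{d_k}$ carry an arbitrary norm $\|\cdot\|$, with dual norm $\|z\|_*=\sup_{\|x\|\le 1}\langle z,x\rangle$. Let $\Xi=\{\xi\in\mathbb R^d: C\xi\preceq f\}$ with $C\in\mathbb R^{r\times d}$, $f\in\mathbb R^r$, where $\preceq$ is the componentwise order. Let $Q=\sum_{l=1}^M\vartheta_l\delta_{\xi^l}$ be a discrete probability distribution with atoms $\xi^l\in\Xi$ and masses $\vartheta_l\ge 0$, $\sum_l\vartheta_l=1$. Let $\varepsilon=(\varepsilon_1,\dots,\varepsilon_n)\succeq 0$, and let the multi-transport hyperrectangle $\mathcal T_1(Q,\varepsilon)$ be the set of the second marginals of all probability measures $\pi$ on $\Xi\times\Xi$ whose first marginal is $Q$ and which satisfy $\int\|\zeta_k-\xi_k\|\,d\pi(\zeta,\xi)\le\varepsilon_k$ for all $k\in\{1,\dots,n\}$. Let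 $m\ge 1$, $\alpha_1,\dots,\alpha_m\in\mathbb R^d$, $b\in\mathbb R^m$, $h_j(\xi)=\langle\alpha_j,\xi\rangle+b_j$, and let $A\in\mathbb R^{m\times d}$ be the matrix with rows $\alpha_j^\top$. (i) If $h=\max_{j}h_j$, then $h$ is integrable with respect to every $P\in\mathcal T_1(Q,\varepsilon)$, and $\sup_{P\in\mathcal T_1(Q,\varepsilon)}\mathbb E_P[h]$ is finite and equal to the value of $$\begin{aligned}\inf_{\lambda\in\mathbb R^n,\ s_l\in\mathbb R,\ \gamma_{lj}\in\mathbb R^r}\ &\langle\lambda,\varepsilon\rangle+\sum_{l=1}^M\vartheta_l s_l\\ \text{s.t.}\quad & b_j+\langle\alpha_j,\xi^l\rangle+\langle\gamma_{lj},f-C\xi^l\rangle\le s_l,\\ &\|\mathrm{pr}_k(C^\top\gamma_{lj}-\alpha_j)\|_*\le\lambda_k,\qquad \gamma_{lj}\succeq 0\end{aligned}$$ (constraints for all $l\in\{1,\dots,M\}$, $j\in\{1,\dots,m\}$, $k\in\{1,\dots,n\}$). (ii) If $h=\min_{j}h_j$, then $h$ is integrable with respect to every $P\in\mathcal T_1(Q,\varepsilon)$,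 and $\sup_{P\in\mathcal T_1(Q,\varepsilon)}\mathbb E_P[h]$ is finite and equal to the value of $$\begin{aligned}\inf_{\lambda\in\mathbb R^n,\ s_l\in\mathbb R,\ \gamma_l\in\mathbb R^r,\ \theta_l\in\mathbb R^m}\ &\langle\lambda,\varepsilon\rangle+\sum_{l=1}^M\vartheta_l s_l\\ \text{s.t.}\quad & \langle\theta_l,b+A\xi^l\rangle+\langle\gamma_l,f-C\xi^l\rangle\le s_l,\\ &\|\mathrm{pr}_k(C^\top\gamma_l-A^\top\theta_l)\|_*\le\lambda_k,\\ &\langle\theta_l,\mathbf 1\rangle=1,\qquad \gamma_l\succeq 0,\quad \theta_l\succeq 0\end{aligned}$$ (constraints for all $l\in\{1,\dots,M\}$, $k\in\{1,\dots,n\}$). -/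

import Mathlib

open MeasureTheory Matrix

noncomputable section

/-- The `k`-th block `x_k ∈ ℝ^{d_k}` of a vector `x ∈ ℝ^d`, `d = d_1 + ⋯ + d_n`
(the coordinates `d_1 + ⋯ + d_{k-1} + i`, `i = 1, …, d_k`). -/
def blockProj {n : ℕ} (d : Fin n → ℕ) (k : Fin n) (x : Fin (∑ k, d k) → ℝ) :
    Fin (d k) → ℝ :=
  fun i => x (finSigmaFinEquiv ⟨k, i⟩)

/-- The dual norm `‖z‖_* = sup {⟨z, x⟩ : ‖x‖ ≤ 1}` of the norm `N` on `ℝ^q`. -/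
def dualNorm {q : ℕ} (N : Seminorm ℝ (Fin q → ℝ)) (z : Fin q → ℝ) : ℝ :=
  sSup ((fun x : Fin q → ℝ => z ⬝ᵥ x) '' {x | N x ≤ 1})

/-- The polyhedron `{ξ : C ξ ⪯ f}`. -/
def polyhedron {r D : ℕ} (C : Matrix (Fin r) (Fin D) ℝ) (f : Fin r → ℝ) :
    Set (Fin D → ℝ) :=
  {ξ | C *ᵥ ξ ≤ f}

/-- The multi-transport hyperrectangle `T_p(Q, ε)`: the second marginals of all probability
measures `π` on `Ξ × Ξ` that have first marginal `Q` and satisfy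
`∫ ρ_k(ζ, ξ)^p dπ(ζ, ξ) ≤ ε_k^p` for every `k`. -/
def multiTransportHyperrectangle {n : ℕ} {Ξ : Type*} [MeasurableSpace Ξ]
    (ρ : Fin n → Ξ → Ξ → ℝ) (p : ℝ) (Q : Measure Ξ) (ε : Fin n → ℝ) : Set (Measure Ξ) :=
  {P | ∃ π : Measure (Ξ × Ξ), IsProbabilityMeasure π ∧ π.map Prod.fst = Q ∧
    (∀ k, ∫⁻ w, ENNReal.ofReal (ρ k w.1 w.2 ^ p) ∂π ≤ ENNReal.ofReal (ε k ^ p)) ∧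
    P = π.map Prod.snd}

/-- The transport cost `‖ζ_k - ξ_k‖` of the `k`-th component, on a set `Ξ ⊆ ℝ^d`. -/
def blockDist {n : ℕ} {d : Fin n → ℕ} (N : ∀ k, Seminorm ℝ (Fin (d k) → ℝ))
    (Ξ : Set (Fin (∑ k, d k) → ℝ)) (k : Fin n) (ζ ξ : Ξ) : ℝ :=
  N k (blockProj d k ζ - blockProj d k ξ)

/-- The discrete measure `∑_l ϑ_l δ_{ξ^l}`. -/
def discreteMeasure {M : ℕ} {Ξ : Type*} [MeasurableSpace Ξ] (ϑ : Fin M → ℝ)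
    (ξ : Fin M → Ξ) : Measure Ξ :=
  ∑ l, ENNReal.ofReal (ϑ l) • Measure.dirac (ξ l)

/-- The objective values attained at the feasible points `(lam, s, γ)` of the finite program
for the pointwise maximum of the affine pieces `⟨α_j, ·⟩ + b_j`, where `α_j` is row `j` of `A`. -/
def maxProgramValues {n r m M : ℕ} {d : Fin n → ℕ}
    (N : ∀ k, Seminorm ℝ (Fin (d k) → ℝ))
    (C : Matrix (Fin r) (Fin (∑ k, d k)) ℝ) (f : Fin r → ℝ)
    (A : Matrix (Fin m) (Fin (∑ k, d k)) ℝ) (b : Fin m → ℝ)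
    (ϑ : Fin M → ℝ) (ξ : Fin M → Fin (∑ k, d k) → ℝ) (ε : Fin n → ℝ) : Set ℝ :=
  {v | ∃ (lam : Fin n → ℝ) (s : Fin M → ℝ) (γ : Fin M → Fin m → Fin r → ℝ),
    (∀ l j, b j + A j ⬝ᵥ ξ l + γ l j ⬝ᵥ (f - C *ᵥ ξ l) ≤ s l) ∧
    (∀ l j k, dualNorm (N k) (blockProj d k (Cᵀ *ᵥ γ l j - A j)) ≤ lam k) ∧
    (∀ l j, 0 ≤ γ l j) ∧
    v = lam ⬝ᵥ ε + ∑ l, ϑ l * s l}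

/-- The objective values attained at the feasible points `(lam, s, γ, θ)` of the finite program
for the pointwise minimum of the affine pieces `⟨α_j, ·⟩ + b_j`, where `α_j` is row `j` of `A`. -/
def minProgramValues {n r m M : ℕ} {d : Fin n → ℕ}
    (N : ∀ k, Seminorm ℝ (Fin (d k) → ℝ))
    (C : Matrix (Fin r) (Fin (∑ k, d k)) ℝ) (f : Fin r → ℝ)
    (A : Matrix (Fin m) (Fin (∑ k, d k)) ℝ) (b : Fin m → ℝ)
    (ϑ : Fin M → ℝ) (ξ : Fin M → Fin (∑ k, d k) → ℝ) (ε : Fin n → ℝ) : Set ℝ :=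
  {v | ∃ (lam : Fin n → ℝ) (s : Fin M → ℝ) (γ : Fin M → Fin r → ℝ) (θ : Fin M → Fin m → ℝ),
    (∀ l, θ l ⬝ᵥ (b + A *ᵥ ξ l) + γ l ⬝ᵥ (f - C *ᵥ ξ l) ≤ s l) ∧
    (∀ l k, dualNorm (N k) (blockProj d k (Cᵀ *ᵥ γ l - Aᵀ *ᵥ θ l)) ≤ lam k) ∧
    (∀ l, θ l ⬝ᵥ 1 = 1) ∧
    (∀ l, 0 ≤ γ l) ∧ (∀ l, 0 ≤ θ l) ∧
    v = lam ⬝ᵥ ε + ∑ l, ϑ l * s l}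

/-- The numbers `E_P[h]`, `P ∈ T`. -/
def expectations {Ξ : Type*} [MeasurableSpace Ξ] (T : Set (Measure Ξ)) (h : Ξ → ℝ) : Set ℝ :=
  (fun P : Measure Ξ => ∫ x, h x ∂P) '' T

end

/-! The worst-case expectation is a linear program over couplings with first marginal $Q$ and $n$
cost budgets. If $\lambda\ge0$ and $h(x)\le s_l+\sum_k\lambda_k\|\xi^l_k-x_k\|$ on $\Xi$ for every
atom, integration against a plan gives $\mathbb
E_P[h]\le\langle\lambda,\varepsilon\rangle+\sum_l\vartheta_l s_l$ (`integral_le`). Since $h$ is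
Lipschitz for the block costs, this already makes the supremum finite.

For the converse, the pairs (cost vector, objective) of all plans form a convex set, and separating
it from the better pairs yields multipliers $\lambda$. Plans that send each atom to one point then
split the Lagrangian bound into one inequality per atom (`exists_isLUB`). Each says that a concave
function, a minimum of affine pieces minus a weighted norm, is at most $s_l$ on a polyhedron;
Hahn–Banach and Farkas turn this into $\gamma,\theta$ (`exists_multipliers_of_min_le`). For a
maximum of pieces the inequality splits further into one per piece.

Two degeneracies need care. If $\varepsilon_k=0$, Slater's condition fails, so that budget stays a
hard constraint and only displacements with vanishing $k$-th block are controlled; but then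
$\lambda_k$ costs nothing and can be enlarged afterwards. Likewise $s_l$ is free when
$\vartheta_l=0$. -/

noncomputable section

/-! ### Farkas' lemma and convex separation -/

/-- **Farkas' lemma** for finitely many homogeneous linear inequalities. -/
theorem exists_nonneg_eq_sum_of_forall_nonpos {E : Type*} [AddCommGroup E] [Module ℝ E] {r : ℕ}
    (c : Fin r → E →ₗ[ℝ] ℝ) (a : E →ₗ[ℝ] ℝ) (h : ∀ y, (∀ i, c i y ≤ 0) → a y ≤ 0) :
    ∃ γ : Fin r → ℝ, 0 ≤ γ ∧ a = ∑ i, γ i • c i := by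
  induction r generalizing a with
  | zero =>
    refine ⟨0, le_rfl, ?_⟩
    ext y
    have h1 := h y (fun i => i.elim0)
    have h2 := h (-y) (fun i => i.elim0)
    simp only [map_neg] at h2
    simp only [Finset.univ_eq_empty, Finset.sum_empty, LinearMap.zero_apply]
    linarith
  | succ r ih =>
    by_cases hc : ∀ y, (∀ i : Fin r, c i.castSucc y ≤ 0) → a y ≤ 0
    · obtain ⟨γ, h0, hγ⟩ := ih _ a hc
      refine ⟨Fin.snoc γ 0, fun i => ?_, ?_⟩
      · refine Fin.lastCases ?_ (fun i => ?_) i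
        · simp
        · simpa using h0 i
      · simpa [Fin.sum_univ_castSucc] using hγ
    · push Not at hc
      obtain ⟨y0, hy0, ha0⟩ := hc
      set cr := c (Fin.last r) with hcr
      have hpos : 0 < cr y0 := by
        by_contra hle
        refine absurd (h y0 fun i => ?_) (not_le.2 ha0)
        refine Fin.lastCases ?_ (fun i => ?_) i
        · exact not_lt.1 hle
        · exact hy0 i
      -- Elimination of the last constraint: project along `y0` onto the kernel of `cr` and apply
      -- the induction hypothesis to the projected functionals.
      obtain ⟨γ, h0, hγ⟩ := ih (fun i => c i.castSucc - (c i.castSucc y0 / cr y0) • cr)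
        (a - (a y0 / cr y0) • cr) (fun y hy => by
          have hz := h (y - (cr y / cr y0) • y0) (fun i => by
            refine Fin.lastCases ?_ (fun i => ?_) i
            · rw [← hcr, map_sub, map_smul, smul_eq_mul, div_mul_cancel₀ _ hpos.ne', sub_self]
            · have := hy i
              simp only [LinearMap.sub_apply, LinearMap.smul_apply, smul_eq_mul] at this
              simp only [map_sub, map_smul, smul_eq_mul]
              calc _ = _ := by ring
                _ ≤ 0 := this)
          simp only [map_sub, map_smul, smul_eq_mul] at hz
          simp only [LinearMap.sub_apply, LinearMap.smul_apply, smul_eq_mul]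
          calc _ = _ := by ring
            _ ≤ 0 := hz)
      refine ⟨Fin.snoc γ (a y0 / cr y0 - ∑ i, γ i * (c i.castSucc y0 / cr y0)), fun i => ?_, ?_⟩
      · refine Fin.lastCases ?_ (fun i => ?_) i
        · simp only [Fin.snoc_last, Pi.zero_apply]
          have h1 : ∑ i, γ i * (c i.castSucc y0 / cr y0) ≤ 0 :=
            Finset.sum_nonpos fun i _ => mul_nonpos_of_nonneg_of_nonpos (h0 i)
              (div_nonpos_of_nonpos_of_nonneg (hy0 i) hpos.le)
          have h2 : 0 < a y0 / cr y0 := div_pos ha0 hpos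
          linarith
        · simpa using h0 i
      · ext y
        have h1 := congrArg (fun g : E →ₗ[ℝ] ℝ => g y) hγ
        simp only [LinearMap.sub_apply, LinearMap.smul_apply, smul_eq_mul, LinearMap.sum_apply,
          mul_sub, Finset.sum_sub_distrib] at h1
        simp only [Fin.sum_univ_castSucc, Fin.snoc_castSucc, Fin.snoc_last, LinearMap.add_apply,
          LinearMap.sum_apply, LinearMap.smul_apply, smul_eq_mul, sub_mul, Finset.sum_mul,
          ← hcr, mul_assoc]
        linarith

/-- **Farkas' lemma** for a consistent finite system of affine inequalities. -/
theorem exists_nonneg_eq_sum_of_forall_le {E : Type*} [AddCommGroup E] [Module ℝ E] {r : ℕ}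
    (c : Fin r → E →ₗ[ℝ] ℝ) (g : Fin r → ℝ) (a : E →ₗ[ℝ] ℝ) (σ : ℝ)
    (hne : ∃ y, ∀ i, c i y ≤ g i) (h : ∀ y, (∀ i, c i y ≤ g i) → a y ≤ σ) :
    ∃ γ : Fin r → ℝ, 0 ≤ γ ∧ a = ∑ i, γ i • c i ∧ ∑ i, γ i * g i ≤ σ := by
  -- Homogenise with an extra variable `τ ≥ 0`; the multiplier of `-τ ≤ 0` becomes the slack in the
  -- final inequality.
  let c' : Fin (r + 1) → (E × ℝ) →ₗ[ℝ] ℝ :=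
    Fin.snoc (α := fun _ => (E × ℝ) →ₗ[ℝ] ℝ)
      (fun i => (c i).comp (LinearMap.fst ℝ E ℝ) - g i • LinearMap.snd ℝ E ℝ)
      (-LinearMap.snd ℝ E ℝ)
  obtain ⟨γ, h0, hγ⟩ := exists_nonneg_eq_sum_of_forall_nonpos c'
    (a.comp (LinearMap.fst ℝ E ℝ) - σ • LinearMap.snd ℝ E ℝ) (by
      rintro ⟨y, τ⟩ hy
      have hτ : 0 ≤ τ := by simpa [c'] using hy (Fin.last r)
      have hy' : ∀ i, c i y ≤ g i * τ := fun i => by simpa [c'] using hy i.castSucc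
      suffices hs : a y ≤ σ * τ by simpa using hs
      -- At `τ = 0` the vector `y` is a recession direction: a positive `a y` would violate the
      -- bound far out along the ray from `y0`.
      rcases hτ.eq_or_lt with rfl | hτ
      · obtain ⟨y0, hy0⟩ := hne
        simp only [mul_zero] at hy' ⊢
        by_contra! hlt
        have hb : ∀ t : ℝ, 0 ≤ t → a y0 + t * a y ≤ σ := fun t ht => by
          have := h (y0 + t • y) fun i => by
            have := mul_nonpos_of_nonneg_of_nonpos ht (hy' i)
            simp only [map_add, map_smul, smul_eq_mul]
            linarith [hy0 i]
          simpa using this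
        have h1 := hb ((|σ - a y0| + 1) / a y) (by positivity)
        rw [div_mul_cancel₀ _ hlt.ne'] at h1
        linarith [le_abs_self (σ - a y0)]
      · have := h (τ⁻¹ • y) fun i => by
          simp only [map_smul, smul_eq_mul]
          rw [inv_mul_le_iff₀ hτ, mul_comm]
          exact hy' i
        simp only [map_smul, smul_eq_mul] at this
        rwa [inv_mul_le_iff₀ hτ, mul_comm] at this)
  refine ⟨fun i => γ i.castSucc, fun i => h0 _, ?_, ?_⟩
  · ext y
    have := congrArg (fun l : (E × ℝ) →ₗ[ℝ] ℝ => l (y, 0)) hγ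
    simpa [c', Fin.sum_univ_castSucc] using this
  · have := congrArg (fun l : (E × ℝ) →ₗ[ℝ] ℝ => l (0, 1)) hγ
    simp [c', Fin.sum_univ_castSucc] at this
    have hl := h0 (Fin.last r)
    simp only [Pi.zero_apply] at hl
    linarith

theorem Seminorm.continuous_of_finiteDimensional {E : Type*} [NormedAddCommGroup E]
    [NormedSpace ℝ E] [FiniteDimensional ℝ E] (p : Seminorm ℝ E) : Continuous p :=
  p.convexOn.locallyLipschitz.continuous

/-- Lagrange multipliers for maximising a linear functional minus a seminorm over a nonempty
polyhedron. -/
theorem exists_nonneg_sub_sum_le_seminorm {E : Type*} [NormedAddCommGroup E]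
    [NormedSpace ℝ E] [FiniteDimensional ℝ E] {r : ℕ} (p : Seminorm ℝ E)
    (c : Fin r → E →ₗ[ℝ] ℝ) (g : Fin r → ℝ) (a : E →ₗ[ℝ] ℝ) (σ : ℝ)
    (hne : ∃ y, ∀ i, c i y ≤ g i) (h : ∀ y, (∀ i, c i y ≤ g i) → a y - p y ≤ σ) :
    ∃ γ : Fin r → ℝ, 0 ≤ γ ∧ (∀ y, a y - ∑ i, γ i * c i y ≤ p y) ∧ ∑ i, γ i * g i ≤ σ := by
  have hpc := p.continuous_of_finiteDimensional
  have hac := a.continuous_of_finiteDimensional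
  -- Separate the strict hypograph of `a - p - σ` from polyhedron × `[0, ∞)`. The result is an
  -- affine function above `a - p - σ` everywhere and nonpositive on the polyhedron, to which Farkas
  -- applies.
  obtain ⟨F, u, hFs, hFt⟩ := geometric_hahn_banach_open
    (s := {w : E × ℝ | w.2 + p w.1 - a w.1 + σ < 0})
    (t := {w : E × ℝ | (∀ i, c i w.1 ≤ g i) ∧ 0 ≤ w.2})
    (by
      rintro ⟨x, s⟩ hx ⟨y, t⟩ hy α β hα hβ hαβ
      simp only [Set.mem_ofPred_eq, Prod.fst_add, Prod.smul_fst, Prod.snd_add, Prod.smul_snd,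
        smul_eq_mul, map_add, map_smul] at hx hy ⊢
      have h1 : p (α • x + β • y) ≤ α * p x + β * p y := by
        refine (map_add_le_add p _ _).trans_eq ?_
        rw [map_smul_eq_mul, map_smul_eq_mul, Real.norm_of_nonneg hα, Real.norm_of_nonneg hβ]
      have h2 : σ = α * σ + β * σ := by rw [← add_mul, hαβ, one_mul]
      rcases hα.eq_or_lt with rfl | hα
      · obtain rfl : β = 1 := by linarith
        linarith
      · nlinarith [mul_neg_of_pos_of_neg hα hx, mul_nonpos_of_nonneg_of_nonpos hβ hy.le])
    (isOpen_lt (by fun_prop) continuous_const)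
    (by
      rintro ⟨x, s⟩ hx ⟨y, t⟩ hy α β hα hβ hαβ
      refine ⟨fun i => ?_, ?_⟩
      · simp only [Prod.fst_add, Prod.smul_fst, map_add, map_smul, smul_eq_mul]
        calc α * c i x + β * c i y ≤ α * g i + β * g i :=
              add_le_add (mul_le_mul_of_nonneg_left (hx.1 i) hα)
                (mul_le_mul_of_nonneg_left (hy.1 i) hβ)
          _ = g i := by rw [← add_mul, hαβ, one_mul]
      · exact add_nonneg (mul_nonneg hα hx.2) (mul_nonneg hβ hy.2))
    (Set.disjoint_left.2 fun w hw hw' => by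
      have := h w.1 hw'.1
      have h3 := hw'.2
      simp only [Set.mem_ofPred_eq] at hw
      linarith)
  set L : E →ₗ[ℝ] ℝ := F.toLinearMap.comp (LinearMap.inl ℝ E ℝ) with hL
  set κ : ℝ := F (0, 1) with hκ
  have hF : ∀ y t, F (y, t) = L y + t * κ := fun y t => by
    have : ((y, t) : E × ℝ) = (y, 0) + t • (0, 1) := by simp
    rw [this, map_add, map_smul, smul_eq_mul]
    rfl
  obtain ⟨y0, hy0⟩ := hne
  have h0 : u ≤ L y0 := by simpa [hF] using hFt (y0, 0) ⟨hy0, le_rfl⟩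
  have hs : ∀ y t, t < a y - p y - σ → L y + t * κ < u := fun y t ht => by
    rw [← hF]
    exact hFs (y, t) (by simp only [Set.mem_ofPred_eq]; linarith)
  have hκpos : 0 < κ := by
    by_contra! hle
    have h1 := hs y0 (min 0 (a y0 - p y0 - σ - 1)) ((min_le_right _ _).trans_lt (by linarith))
    have h2 := mul_nonneg_of_nonpos_of_nonpos (min_le_left 0 (a y0 - p y0 - σ - 1)) hle
    linarith
  have hsle : ∀ y, L y + (a y - p y - σ) * κ ≤ u := fun y => by
    refine le_of_forall_pos_lt_add fun δ hδ => ?_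
    have h1 := hs y (a y - p y - σ - δ / κ) (by linarith [div_pos hδ hκpos])
    rw [sub_mul _ (δ / κ), div_mul_cancel₀ _ hκpos.ne'] at h1
    linarith
  obtain ⟨γ, hγ0, hγ, hγg⟩ := exists_nonneg_eq_sum_of_forall_le c g ((-κ⁻¹) • L) (-(κ⁻¹ * u))
    ⟨y0, hy0⟩ (fun y hy => by
      have h1 : u ≤ L y := by simpa [hF] using hFt (y, 0) ⟨hy, le_rfl⟩
      have := mul_le_mul_of_nonneg_left h1 (inv_pos.2 hκpos).le
      simp only [LinearMap.smul_apply, smul_eq_mul]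
      linarith)
  have hLγ : ∀ y, ∑ i, γ i * c i y = -κ⁻¹ * L y := fun y => by
    simpa using (congrArg (fun l : E →ₗ[ℝ] ℝ => l y) hγ).symm
  have haff : ∀ y, a y - p y - σ ≤ κ⁻¹ * u - κ⁻¹ * L y := fun y => by
    rw [← mul_sub, inv_mul_eq_div, le_div_iff₀ hκpos]
    linarith [hsle y]
  refine ⟨γ, hγ0, fun y => ?_, ?_⟩
  · rw [hLγ]
    by_contra! hlt
    set δ := a y - -κ⁻¹ * L y - p y with hδ
    have hδ0 : 0 < δ := by rw [hδ]; linarith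
    -- Homogeneity of `p`: along a ray the affine bound can hold only if its linear part does.
    have key : ∀ t : ℝ, 0 ≤ t → t * δ ≤ σ + κ⁻¹ * u := fun t ht => by
      have := haff (t • y)
      rw [map_smul_eq_mul p, map_smul, map_smul, Real.norm_of_nonneg ht, smul_eq_mul,
        smul_eq_mul] at this
      rw [hδ]
      linarith
    have h1 := key ((|σ + κ⁻¹ * u| + 1) / δ) (by positivity)
    rw [div_mul_cancel₀ _ hδ0.ne'] at h1
    linarith [le_abs_self (σ + κ⁻¹ * u)]
  · have := haff 0
    simp only [map_zero, mul_zero] at this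
    linarith

/-- Lagrange multipliers for convex budget constraints `c ≤ ε`: the coordinates where `ε`
vanishes are kept as hard constraints, so that no Slater condition is needed for them. -/
theorem exists_nonneg_lagrange_of_convex {n : ℕ} {B : Set ((Fin n → ℝ) × ℝ)} (hB : Convex ℝ B)
    {ε : Fin n → ℝ} (hε : ∀ k, 0 ≤ ε k) {t₀ V : ℝ} (h0 : ((0 : Fin n → ℝ), t₀) ∈ B)
    (hV : ∀ w ∈ B, w.1 ≤ ε → w.2 ≤ V) :
    ∃ lam : Fin n → ℝ, 0 ≤ lam ∧ ∀ w ∈ B, (∀ k, ε k = 0 → w.1 k = 0) →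
      lam ⬝ᵥ ε + (w.2 - lam ⬝ᵥ w.1) ≤ V := by
  have hset : {w : (Fin n → ℝ) × ℝ | (∀ k, 0 < ε k → w.1 k < ε k) ∧ V < w.2} =
      (⋂ k, {w : (Fin n → ℝ) × ℝ | 0 < ε k → w.1 k < ε k}) ∩ {w | V < w.2} := by
    ext w
    simp
  -- The open set leaves the coordinates with `ε k = 0` unrestricted, which forces `μ k = 0` there;
  -- the other set carries them as equalities.
  obtain ⟨F, u, hFs, hFt⟩ := geometric_hahn_banach_open
    (s := {w : (Fin n → ℝ) × ℝ | (∀ k, 0 < ε k → w.1 k < ε k) ∧ V < w.2})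
    (t := {w : (Fin n → ℝ) × ℝ | w ∈ B ∧ ∀ k, ε k = 0 → w.1 k = 0})
    (by
      have h1 : Convex ℝ {w : (Fin n → ℝ) × ℝ | V < w.2} :=
        convex_halfSpace_gt (LinearMap.snd ℝ (Fin n → ℝ) ℝ).isLinear V
      have h2 : ∀ k, Convex ℝ {w : (Fin n → ℝ) × ℝ | 0 < ε k → w.1 k < ε k} := fun k => by
        by_cases hk : 0 < ε k
        · simpa [hk] using convex_halfSpace_lt
            ((LinearMap.proj k).comp (LinearMap.fst ℝ (Fin n → ℝ) ℝ)).isLinear (ε k)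
        · simpa [hk] using convex_univ
      rw [hset]
      exact (convex_iInter h2).inter h1)
    (by
      have h1 : IsOpen {w : (Fin n → ℝ) × ℝ | V < w.2} := isOpen_lt continuous_const continuous_snd
      have h2 : ∀ k, IsOpen {w : (Fin n → ℝ) × ℝ | 0 < ε k → w.1 k < ε k} := fun k => by
        by_cases hk : 0 < ε k
        · simpa [hk] using isOpen_lt
            ((continuous_apply k).comp continuous_fst) continuous_const
        · simp [hk]
      rw [hset]
      exact (isOpen_iInter_of_finite h2).inter h1)
    (by
      rintro w hw w' hw' α β hα hβ hαβ
      refine ⟨hB hw.1 hw'.1 hα hβ hαβ, fun k hk => ?_⟩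
      simp [hw.2 k hk, hw'.2 k hk])
    (Set.disjoint_left.2 fun w hw hw' => by
      refine absurd (hV w hw'.1 fun k => ?_) (not_le.2 hw.2)
      rcases (hε k).eq_or_lt with hk | hk
      · rw [← hk, hw'.2 k hk.symm]
      · exact (hw.1 k hk).le)
  set μ : Fin n → ℝ := fun k => F (Pi.single k 1, 0) with hμ
  set τ : ℝ := F (0, 1) with hτ
  have hF : ∀ w, F w = μ ⬝ᵥ w.1 + τ * w.2 := fun w => by
    have h1 : w = ∑ k, w.1 k • ((Pi.single k (1 : ℝ), 0) : (Fin n → ℝ) × ℝ) +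
        w.2 • ((0 : Fin n → ℝ), (1 : ℝ)) := by
      ext j
      · simp [Prod.fst_sum, Finset.sum_apply, Pi.single_apply]
      · simp [Prod.snd_sum]
    conv_lhs => rw [h1]
    simp only [map_add, map_sum, map_smul, smul_eq_mul, dotProduct]
    rw [mul_comm τ]
    simp only [mul_comm, hμ, hτ]
  have hu : u ≤ τ * t₀ := by simpa [hF] using hFt (0, t₀) ⟨h0, fun k _ => rfl⟩
  have hclose : ∀ e : Fin n → ℝ, (∀ k, 0 < ε k → e k < ε k) → ∀ t, V < t →
      μ ⬝ᵥ e + τ * t < u := fun e he t ht => by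
    have := hFs (e, t) ⟨he, ht⟩
    rwa [hF] at this
  have hμk : ∀ k x, (0 < ε k → x ≤ 0) → μ k * x + τ * (V + 1) < u := fun k x hx => by
    have := hclose (Pi.single k x) (fun j hj => by
      rcases eq_or_ne j k with rfl | hjk
      · simpa using (hx hj).trans_lt hj
      · simpa [hjk] using hj) (V + 1) (by linarith)
    simpa using this
  have hμ0 : ∀ k, 0 ≤ μ k := fun k => by
    by_contra! hlt
    have h1 := hμk k ((|u - τ * (V + 1)| + 1) / μ k)
      (fun _ => div_nonpos_of_nonneg_of_nonpos (by positivity) hlt.le)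
    rw [mul_div_cancel₀ _ hlt.ne] at h1
    linarith [le_abs_self (u - τ * (V + 1))]
  have hμz : ∀ k, ε k = 0 → μ k = 0 := fun k hk => by
    by_contra hne
    have h1 := hμk k ((|u - τ * (V + 1)| + 1) / μ k) (fun h => absurd hk h.ne')
    rw [mul_div_cancel₀ _ hne] at h1
    linarith [le_abs_self (u - τ * (V + 1))]
  -- The point `(0, t₀)` satisfies the positive budgets strictly, so it plays the role of the Slater
  -- point and excludes a vertical hyperplane.
  have hτneg : τ < 0 := by
    by_contra! hle
    have h1 := hclose 0 (fun k hk => hk) (max (V + 1) t₀)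
      ((by linarith : V < V + 1).trans_le (le_max_left _ _))
    have h2 := mul_le_mul_of_nonneg_left (le_max_right (V + 1) t₀) hle
    simp only [dotProduct_zero] at h1
    linarith
  have hlim : μ ⬝ᵥ ε + τ * V ≤ u := by
    have hc : Filter.Tendsto (fun δ : ℝ => μ ⬝ᵥ (fun k => ε k - δ) + τ * (V + δ))
        (nhdsWithin 0 (Set.Ioi 0)) (nhds (μ ⬝ᵥ (fun k => ε k - 0) + τ * (V + 0))) := by
      refine (Continuous.tendsto ?_ 0).mono_left nhdsWithin_le_nhds
      unfold dotProduct
      fun_prop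
    simp only [sub_zero, add_zero] at hc
    refine le_of_tendsto hc (Filter.eventually_of_mem self_mem_nhdsWithin fun δ hδ => ?_)
    have hδ : 0 < δ := hδ
    exact (hclose _ (fun k _ => by linarith) _ (by linarith)).le
  refine ⟨fun k => μ k / (-τ), fun k => div_nonneg (hμ0 k) (by linarith), fun w hw hwz => ?_⟩
  have h1 := hFt w ⟨hw, hwz⟩
  rw [hF] at h1
  have hsm : (fun k => μ k / (-τ)) = (-τ)⁻¹ • μ := by
    ext k
    simp [div_eq_inv_mul]
  have h2 : μ ⬝ᵥ ε - μ ⬝ᵥ w.1 ≤ (V - w.2) * (-τ) := by linarith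
  rw [← div_le_iff₀ (by linarith), div_eq_inv_mul, mul_sub] at h2
  rw [hsm, smul_dotProduct, smul_dotProduct, smul_eq_mul, smul_eq_mul]
  linarith

/-! ### Discrete measures and independent choices -/

theorem integrable_discreteMeasure {X : Type*} [MeasurableSpace X] [MeasurableSingletonClass X]
    {M : ℕ} (ϑ : Fin M → ℝ) (ξ : Fin M → X) (S : X → ℝ) :
    Integrable S (discreteMeasure ϑ ξ) :=
  integrable_finsetSum_measure.2 fun _ _ =>
    (integrable_dirac (by simp)).smul_measure ENNReal.ofReal_ne_top

theorem integral_discreteMeasure {X : Type*} [MeasurableSpace X] [MeasurableSingletonClass X]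
    {M : ℕ} {ϑ : Fin M → ℝ} (hϑ : ∀ l, 0 ≤ ϑ l) (ξ : Fin M → X) (S : X → ℝ) :
    ∫ x, S x ∂(discreteMeasure ϑ ξ) = ∑ l, ϑ l * S (ξ l) := by
  unfold discreteMeasure
  rw [integral_finsetSum_measure fun _ _ =>
    (integrable_dirac (by simp)).smul_measure ENNReal.ofReal_ne_top]
  refine Finset.sum_congr rfl fun l _ => ?_
  rw [integral_smul_measure, integral_dirac, ENNReal.toReal_ofReal (hϑ l), smul_eq_mul]

theorem map_discreteMeasure {X Y : Type*} [MeasurableSpace X] [MeasurableSpace Y]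
    {M : ℕ} (ϑ : Fin M → ℝ) (ξ : Fin M → X) {φ : X → Y} (hφ : Measurable φ) :
    (discreteMeasure ϑ ξ).map φ = discreteMeasure ϑ (φ ∘ ξ) := by
  unfold discreteMeasure
  rw [← Measure.mapₗ_apply_of_measurable hφ, map_sum]
  refine Finset.sum_congr rfl fun l _ => ?_
  rw [Measure.mapₗ_apply_of_measurable hφ, Measure.map_smul, Measure.map_dirac' hφ]
  rfl

theorem isProbabilityMeasure_discreteMeasure {X : Type*} [MeasurableSpace X]
    {M : ℕ} {ϑ : Fin M → ℝ} (hϑ : ∀ l, 0 ≤ ϑ l) (hϑ1 : ∑ l, ϑ l = 1) (ξ : Fin M → X) :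
    IsProbabilityMeasure (discreteMeasure ϑ ξ) := by
  constructor
  simp [discreteMeasure, Measure.finsetSum_apply, ← ENNReal.ofReal_sum_of_nonneg fun l _ => hϑ l,
    hϑ1]

theorem ae_mem_range_discreteMeasure {X : Type*} [MeasurableSpace X] [MeasurableSingletonClass X]
    {M : ℕ} (ϑ : Fin M → ℝ) (ξ : Fin M → X) :
    ∀ᵐ x ∂(discreteMeasure ϑ ξ), x ∈ Set.range ξ := by
  have hm : MeasurableSet (Set.range ξ)ᶜ := (Set.finite_range ξ).measurableSet.compl
  rw [ae_iff]
  change discreteMeasure ϑ ξ (Set.range ξ)ᶜ = 0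
  simp [discreteMeasure, Measure.finsetSum_apply, Measure.dirac_apply' _ hm]

/-- A bound on weighted sums over independent choices splits into separate bounds. -/
theorem exists_sum_le_of_forall_choice {X : Type*} {M : ℕ} {ϑ : Fin M → ℝ} (hϑ : ∀ l, 0 ≤ ϑ l)
    (g : Fin M → X → ℝ) (K : Fin M → Set X) (hK : ∀ l, (K l).Nonempty) (W : ℝ)
    (h : ∀ x : Fin M → X, (∀ l, x l ∈ K l) → ∑ l, ϑ l * g l (x l) ≤ W) :
    ∃ s : Fin M → ℝ, ∑ l, ϑ l * s l ≤ W ∧ ∀ l, 0 < ϑ l → ∀ x ∈ K l, g l x ≤ s l := by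
  choose x0 hx0 using hK
  have hbdd : ∀ l, 0 < ϑ l → BddAbove (g l '' K l) := fun l hl => by
    refine ⟨(W - ∑ i ∈ Finset.univ.erase l, ϑ i * g i (x0 i)) / ϑ l, ?_⟩
    rintro _ ⟨x, hx, rfl⟩
    have := h (Function.update x0 l x) fun i => by
      rcases eq_or_ne i l with rfl | hi
      · simpa using hx
      · simpa [hi] using hx0 i
    rw [← Finset.add_sum_erase _ _ (Finset.mem_univ l)] at this
    rw [Finset.sum_congr rfl fun i hi => by
      rw [Function.update_of_ne (Finset.ne_of_mem_erase hi)]] at this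
    rw [le_div_iff₀ hl]
    simp only [Function.update_self] at this
    linarith
  -- At zero weight this supremum may be a junk value; it is multiplied by zero and nothing is
  -- claimed about it.
  refine ⟨fun l => sSup (g l '' K l), ?_, fun l hl x hx =>
    le_csSup (hbdd l hl) (Set.mem_image_of_mem _ hx)⟩
  refine le_of_forall_pos_le_add fun δ hδ => ?_
  set δ' := δ / (∑ l, ϑ l + 1) with hδ'
  have hpos : 0 < ∑ l, ϑ l + 1 := by
    have := Finset.sum_nonneg fun l (_ : l ∈ Finset.univ) => hϑ l
    linarith
  have hδ'0 : 0 < δ' := div_pos hδ hpos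
  have hx : ∀ l, ∃ x ∈ K l, 0 < ϑ l → sSup (g l '' K l) - δ' ≤ g l x := fun l => by
    obtain ⟨_, ⟨x, hx, rfl⟩, hlt⟩ := exists_lt_of_lt_csSup
      (⟨_, Set.mem_image_of_mem (g l) (hx0 l)⟩ : (g l '' K l).Nonempty)
      (by linarith : sSup (g l '' K l) - δ' < sSup (g l '' K l))
    exact ⟨x, hx, fun _ => hlt.le⟩
  choose x hxK hx using hx
  calc ∑ l, ϑ l * sSup (g l '' K l) ≤ ∑ l, (ϑ l * g l (x l) + ϑ l * δ') := by
        refine Finset.sum_le_sum fun l _ => ?_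
        rcases (hϑ l).eq_or_lt with hl | hl
        · simp [← hl]
        · rw [← mul_add]
          exact mul_le_mul_of_nonneg_left (by linarith [hx l hl]) hl.le
    _ = ∑ l, ϑ l * g l (x l) + (∑ l, ϑ l) * δ' := by rw [Finset.sum_add_distrib, Finset.sum_mul]
    _ ≤ W + δ := by
        have h1 := h x hxK
        have h2 : (∑ l, ϑ l + 1) * δ' = δ := by rw [hδ', mul_div_cancel₀ _ hpos.ne']
        linarith

/-! ### Duality for multi-transport problems -/

/-- Joint data of a multi-transport problem with linear growth: the transport costs `ρ`, the
objective `h`, and Lipschitz constants `L` of `h` with respect to `ρ`. -/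
structure IsTransportLipschitz {n : ℕ} {X : Type*} [MeasurableSpace X]
    (ρ : Fin n → X → X → ℝ) (h : X → ℝ) (L : Fin n → ℝ) : Prop where
  measurable_cost : ∀ k, Measurable fun w : X × X => ρ k w.1 w.2
  cost_nonneg : ∀ k x y, 0 ≤ ρ k x y
  cost_self : ∀ k x, ρ k x x = 0
  measurable : Measurable h
  nonneg : 0 ≤ L
  lipschitz : ∀ x y, |h y - h x| ≤ ∑ k, L k * ρ k x y

namespace IsTransportLipschitz

variable {n M : ℕ} {X : Type*} [MeasurableSpace X] {ρ : Fin n → X → X → ℝ} {h : X → ℝ}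
  {L : Fin n → ℝ} {ϑ : Fin M → ℝ} {ξ : Fin M → X} {ε : Fin n → ℝ}

theorem integrable_cost (H : IsTransportLipschitz ρ h L) {π : Measure (X × X)}
    (hπ : ∀ k, ∫⁻ w, ENNReal.ofReal (ρ k w.1 w.2 ^ (1 : ℝ)) ∂π ≤ ENNReal.ofReal (ε k ^ (1 : ℝ)))
    (k : Fin n) : Integrable (fun w : X × X => ρ k w.1 w.2) π := by
  refine ⟨(H.measurable_cost k).aestronglyMeasurable, ?_⟩
  rw [hasFiniteIntegral_iff_ofReal (Filter.Eventually.of_forall fun w => H.cost_nonneg k _ _)]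
  simpa using (hπ k).trans_lt ENNReal.ofReal_lt_top

theorem integral_cost_le (H : IsTransportLipschitz ρ h L) (hε : ∀ k, 0 ≤ ε k)
    {π : Measure (X × X)}
    (hπ : ∀ k, ∫⁻ w, ENNReal.ofReal (ρ k w.1 w.2 ^ (1 : ℝ)) ∂π ≤ ENNReal.ofReal (ε k ^ (1 : ℝ)))
    (k : Fin n) : ∫ w, ρ k w.1 w.2 ∂π ≤ ε k := by
  rw [integral_eq_lintegral_of_nonneg_ae
    (Filter.Eventually.of_forall fun w => H.cost_nonneg k _ _)
    (H.measurable_cost k).aestronglyMeasurable]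
  refine ENNReal.toReal_le_of_le_ofReal (hε k) ?_
  simpa using hπ k

/-- The cost vectors and expected objectives of all transport plans with finite cost. -/
def planValues (ρ : Fin n → X → X → ℝ) (h : X → ℝ) (Q : Measure X) : Set ((Fin n → ℝ) × ℝ) :=
  {w | ∃ π : Measure (X × X), IsProbabilityMeasure π ∧ π.map Prod.fst = Q ∧
    (∀ k, Integrable (fun z : X × X => ρ k z.1 z.2) π) ∧
    (∀ k, w.1 k = ∫ z, ρ k z.1 z.2 ∂π) ∧ w.2 = ∫ z, h z.2 ∂π}

theorem mem_expectations_of_mem_planValues (H : IsTransportLipschitz ρ h L)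
    {Q : Measure X} {w : (Fin n → ℝ) × ℝ} (hw : w ∈ planValues ρ h Q) (hwε : w.1 ≤ ε) :
    w.2 ∈ expectations (multiTransportHyperrectangle ρ 1 Q ε) h := by
  obtain ⟨π, hp, hfst, hi, hc, ht⟩ := hw
  refine ⟨π.map Prod.snd, ⟨π, hp, hfst, fun k => ?_, rfl⟩, ?_⟩
  · simp only [Real.rpow_one]
    rw [← ofReal_integral_eq_lintegral_ofReal (hi k)
      (Filter.Eventually.of_forall fun z => H.cost_nonneg k _ _), ← hc]
    exact ENNReal.ofReal_le_ofReal (hwε k)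
  · simp only
    rw [integral_map measurable_snd.aemeasurable H.measurable.aestronglyMeasurable, ht]

variable [MeasurableSingletonClass X]

theorem integrable_comp_fst {π : Measure (X × X)}
    (hfst : π.map Prod.fst = discreteMeasure ϑ ξ) (S : X → ℝ) :
    Integrable (fun w : X × X => S w.1) π := by
  have h1 := integrable_discreteMeasure ϑ ξ S
  rw [← hfst] at h1
  exact h1.comp_measurable measurable_fst

/-- The Lipschitz bound dominates $|h|$ at the target by $|h|$ at the source, integrable because the
first marginal has finitely many atoms, plus the integrable costs. -/
theorem integrable_comp_snd (H : IsTransportLipschitz ρ h L) {π : Measure (X × X)}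
    (hfst : π.map Prod.fst = discreteMeasure ϑ ξ)
    (hρ : ∀ k, Integrable (fun w : X × X => ρ k w.1 w.2) π) :
    Integrable (fun w : X × X => h w.2) π := by
  have h2 : Integrable (fun w : X × X => |h w.1| + ∑ k, L k * ρ k w.1 w.2) π :=
    (integrable_comp_fst hfst fun x => |h x|).add
      (integrable_finsetSum _ fun k _ => (hρ k).const_mul (L k))
  refine h2.mono' (H.measurable.comp measurable_snd).aestronglyMeasurable
    (Filter.Eventually.of_forall fun w => ?_)
  rw [Real.norm_eq_abs]
  have h3 := H.lipschitz w.1 w.2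
  have h4 := abs_sub_abs_le_abs_sub (h w.2) (h w.1)
  linarith

theorem integrable_of_mem (H : IsTransportLipschitz ρ h L) {P : Measure X}
    (hP : P ∈ multiTransportHyperrectangle ρ 1 (discreteMeasure ϑ ξ) ε) : Integrable h P := by
  obtain ⟨π, _, hfst, hπ, rfl⟩ := hP
  rw [integrable_map_measure H.measurable.aestronglyMeasurable measurable_snd.aemeasurable]
  exact H.integrable_comp_snd hfst (H.integrable_cost hπ)

/-- Weak duality. -/
theorem integral_le (H : IsTransportLipschitz ρ h L) (hϑ : ∀ l, 0 ≤ ϑ l) (hε : ∀ k, 0 ≤ ε k)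
    {lam : Fin n → ℝ} (hlam : 0 ≤ lam) {s : Fin M → ℝ}
    (hs : ∀ l x, h x ≤ s l + ∑ k, lam k * ρ k (ξ l) x) {P : Measure X}
    (hP : P ∈ multiTransportHyperrectangle ρ 1 (discreteMeasure ϑ ξ) ε) :
    ∫ x, h x ∂P ≤ lam ⬝ᵥ ε + ∑ l, ϑ l * s l := by
  obtain ⟨π, _, hfst, hπ, rfl⟩ := hP
  rw [integral_map measurable_snd.aemeasurable H.measurable.aestronglyMeasurable]
  -- Atoms may coincide, so the bound at a point is the least `s i` over the atoms located there.
  -- Elsewhere the value is irrelevant, being on a null set.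
  let S : X → ℝ := fun ζ => ⨅ i : {l // ξ l = ζ}, s i
  have hS : ∀ l, S (ξ l) ≤ s l := fun l =>
    ciInf_le (Set.finite_range fun i : {i // ξ i = ξ l} => s i).bddBelow ⟨l, rfl⟩
  have hSi := integrable_comp_fst hfst S
  have hρi : Integrable (fun w : X × X => ∑ k, lam k * ρ k w.1 w.2) π :=
    integrable_finsetSum _ fun k _ => (H.integrable_cost hπ k).const_mul (lam k)
  have hae : ∀ᵐ w ∂π, h w.2 ≤ S w.1 + ∑ k, lam k * ρ k w.1 w.2 := by
    have h1 := ae_mem_range_discreteMeasure ϑ ξ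
    rw [← hfst] at h1
    filter_upwards [ae_of_ae_map measurable_fst.aemeasurable h1] with w hw
    obtain ⟨l, hl⟩ := hw
    have : Nonempty {i // ξ i = w.1} := ⟨⟨l, hl⟩⟩
    rw [← sub_le_iff_le_add]
    refine le_ciInf fun i => ?_
    have h2 := hs i w.2
    rw [i.2] at h2
    linarith
  calc ∫ w, h w.2 ∂π ≤ ∫ w, (S w.1 + ∑ k, lam k * ρ k w.1 w.2) ∂π :=
        integral_mono_ae (H.integrable_comp_snd hfst (H.integrable_cost hπ)) (hSi.add hρi) hae
    _ = ∑ l, ϑ l * S (ξ l) + ∑ k, lam k * ∫ w, ρ k w.1 w.2 ∂π := by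
        rw [integral_add hSi hρi, integral_finsetSum _ fun k _ =>
          (H.integrable_cost hπ k).const_mul (lam k)]
        congr 1
        · rw [← integral_discreteMeasure hϑ ξ S, ← hfst, integral_map measurable_fst.aemeasurable]
          rw [hfst]
          exact (integrable_discreteMeasure ϑ ξ S).aestronglyMeasurable
        · exact Finset.sum_congr rfl fun k _ => integral_const_mul _ _
    _ ≤ ∑ l, ϑ l * s l + lam ⬝ᵥ ε :=
        add_le_add
          (Finset.sum_le_sum fun l _ => mul_le_mul_of_nonneg_left (hS l) (hϑ l))
          (Finset.sum_le_sum fun k _ =>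
            mul_le_mul_of_nonneg_left (H.integral_cost_le hε hπ k) (hlam k))
    _ = _ := add_comm _ _

theorem convex_planValues (H : IsTransportLipschitz ρ h L) :
    Convex ℝ (planValues ρ h (discreteMeasure ϑ ξ)) := by
  rintro w ⟨π, hp, hfst, hi, hc, ht⟩ w' ⟨π', hp', hfst', hi', hc', ht'⟩ α β hα hβ hαβ
  have hαβ' : ENNReal.ofReal α + ENNReal.ofReal β = 1 := by
    rw [← ENNReal.ofReal_add hα hβ, hαβ, ENNReal.ofReal_one]
  have key : ∀ g : X × X → ℝ, Integrable g π → Integrable g π' →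
      ∫ z, g z ∂(ENNReal.ofReal α • π + ENNReal.ofReal β • π') =
        α * ∫ z, g z ∂π + β * ∫ z, g z ∂π' := fun g hg hg' => by
    rw [integral_add_measure (hg.smul_measure ENNReal.ofReal_ne_top)
      (hg'.smul_measure ENNReal.ofReal_ne_top), integral_smul_measure, integral_smul_measure,
      ENNReal.toReal_ofReal hα, ENNReal.toReal_ofReal hβ, smul_eq_mul, smul_eq_mul]
  refine ⟨ENNReal.ofReal α • π + ENNReal.ofReal β • π', ⟨?_⟩, ?_, fun k => ?_, fun k => ?_, ?_⟩
  · simp [hαβ']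
  · rw [Measure.map_add _ _ measurable_fst, Measure.map_smul, Measure.map_smul, hfst, hfst',
      ← add_smul, hαβ', one_smul]
  · exact ((hi k).smul_measure ENNReal.ofReal_ne_top).add_measure
      ((hi' k).smul_measure ENNReal.ofReal_ne_top)
  · rw [key _ (hi k) (hi' k), ← hc, ← hc']
    simp
  · rw [key _ (H.integrable_comp_snd hfst hi) (H.integrable_comp_snd hfst' hi'), ← ht, ← ht']
    simp

/-- Realised by the plan that moves the whole mass of atom `l` to `x l`. The independent choice of
targets is what decouples the atoms. -/
theorem mem_planValues (hϑ : ∀ l, 0 ≤ ϑ l) (hϑ1 : ∑ l, ϑ l = 1) (x : Fin M → X) :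
    ((fun k => ∑ l, ϑ l * ρ k (ξ l) (x l)), ∑ l, ϑ l * h (x l)) ∈
      planValues ρ h (discreteMeasure ϑ ξ) := by
  refine ⟨discreteMeasure ϑ fun l => (ξ l, x l),
    isProbabilityMeasure_discreteMeasure hϑ hϑ1 _, ?_, fun k => integrable_discreteMeasure _ _ _,
    fun k => ?_, ?_⟩
  · rw [map_discreteMeasure _ _ measurable_fst]
    rfl
  · rw [integral_discreteMeasure hϑ]
  · rw [integral_discreteMeasure hϑ]

/-- Strong duality: the worst-case expectation is finite, and it is attained by a dual solution
whose constraints are imposed only at the atoms of positive mass and only along the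
displacements that the vanishing budgets permit. -/
theorem exists_isLUB (H : IsTransportLipschitz ρ h L) (hϑ : ∀ l, 0 ≤ ϑ l)
    (hϑ1 : ∑ l, ϑ l = 1) (hε : ∀ k, 0 ≤ ε k) :
    ∃ v : ℝ, IsLUB
        (expectations (multiTransportHyperrectangle ρ 1 (discreteMeasure ϑ ξ) ε) h) v ∧
      ∃ lam : Fin n → ℝ, 0 ≤ lam ∧ ∃ s : Fin M → ℝ, lam ⬝ᵥ ε + ∑ l, ϑ l * s l ≤ v ∧
        ∀ l, 0 < ϑ l → ∀ x, (∀ k, ε k = 0 → ρ k (ξ l) x = 0) →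
          h x ≤ s l + ∑ k, lam k * ρ k (ξ l) x := by
  have h0 : ((0 : Fin n → ℝ), ∑ l, ϑ l * h (ξ l)) ∈ planValues ρ h (discreteMeasure ϑ ξ) := by
    have := mem_planValues (ρ := ρ) (h := h) (ξ := ξ) hϑ hϑ1 ξ
    simp only [H.cost_self, mul_zero, Finset.sum_const_zero] at this
    exact this
  obtain ⟨v, hlub⟩ := Real.exists_isLUB
    (⟨_, H.mem_expectations_of_mem_planValues h0 hε⟩ : Set.Nonempty
      (expectations (multiTransportHyperrectangle ρ 1 (discreteMeasure ϑ ξ) ε) h))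
    -- Weak duality with the Lipschitz constants as `lam` and `s l = h (ξ l)`.
    ⟨L ⬝ᵥ ε + ∑ l, ϑ l * h (ξ l), by
      rintro _ ⟨P, hP, rfl⟩
      refine H.integral_le hϑ hε H.nonneg (fun l x => ?_) hP
      linarith [le_abs_self (h x - h (ξ l)), H.lipschitz (ξ l) x]⟩
  refine ⟨v, hlub, ?_⟩
  obtain ⟨lam, hlam, hB⟩ := exists_nonneg_lagrange_of_convex H.convex_planValues hε h0
    fun w hw hwε => hlub.1 (H.mem_expectations_of_mem_planValues hw hwε)
  refine ⟨lam, hlam, ?_⟩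
  obtain ⟨s, hs, hsl⟩ := exists_sum_le_of_forall_choice hϑ
    (fun l x => h x - ∑ k, lam k * ρ k (ξ l) x)
    (fun l => {x | ∀ k, ε k = 0 → ρ k (ξ l) x = 0}) (fun l => ⟨ξ l, fun k _ => H.cost_self k _⟩)
    (v - lam ⬝ᵥ ε) (fun x hx => by
      have h1 := hB _ (mem_planValues hϑ hϑ1 x) fun k hk => by
        change ∑ l, ϑ l * ρ k (ξ l) (x l) = 0
        refine Finset.sum_eq_zero fun l _ => ?_
        rw [hx l k hk, mul_zero]
      rw [le_sub_iff_add_le']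
      refine Eq.trans_le ?_ h1
      simp only [dotProduct, mul_sub, Finset.sum_sub_distrib, Finset.mul_sum]
      congr 2
      rw [Finset.sum_comm]
      exact Finset.sum_congr rfl fun k _ => Finset.sum_congr rfl fun l _ => by ring)
  exact ⟨s, by linarith, fun l hl x hx => by linarith [hsl l hl x hx]⟩

end IsTransportLipschitz

/-! ### Dual norms -/

section DualNorm

variable {q : ℕ} {N : Seminorm ℝ (Fin q → ℝ)}

/-- `N` has a positive minimum on the compact unit sphere, whose inverse serves as `K`; the sphere
is empty only in dimension zero. This makes the supremum in `dualNorm` finite. -/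
theorem exists_norm_le_mul_of_definite (hN : ∀ x, N x = 0 → x = 0) :
    ∃ K, ∀ x, ‖x‖ ≤ K * N x := by
  by_cases hne : (Metric.sphere (0 : Fin q → ℝ) 1).Nonempty
  · obtain ⟨x0, hx0, hmin⟩ := (isCompact_sphere (0 : Fin q → ℝ) 1).exists_isMinOn hne
      N.continuous_of_finiteDimensional.continuousOn
    have hpos : 0 < N x0 := (apply_nonneg N x0).lt_of_ne' fun h0 => by
      rw [hN x0 h0] at hx0
      simp at hx0
    refine ⟨(N x0)⁻¹, fun x => ?_⟩
    rcases eq_or_ne x 0 with rfl | hx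
    · simp
    have hx' : 0 < ‖x‖ := norm_pos_iff.2 hx
    have h1 : N x0 ≤ N (‖x‖⁻¹ • x) := hmin (by simp [norm_smul, hx'.ne'])
    rw [map_smul_eq_mul, norm_inv, norm_norm, inv_mul_eq_div, le_div_iff₀ hx'] at h1
    rwa [inv_mul_eq_div, le_div_iff₀ hpos, mul_comm]
  · refine ⟨0, fun x => ?_⟩
    have : x = 0 := by
      by_contra hx
      exact hne ⟨‖x‖⁻¹ • x, by simp [norm_smul, norm_ne_zero_iff.2 hx]⟩
    simp [this]

theorem bddAbove_dualNorm (hN : ∀ x, N x = 0 → x = 0) (z : Fin q → ℝ) :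
    BddAbove ((fun x : Fin q → ℝ => z ⬝ᵥ x) '' {x | N x ≤ 1}) := by
  obtain ⟨K, hK⟩ := exists_norm_le_mul_of_definite hN
  refine ⟨∑ i, |z i| * |K|, ?_⟩
  rintro _ ⟨x, hx, rfl⟩
  refine Finset.sum_le_sum fun i _ => (le_abs_self _).trans ?_
  rw [abs_mul]
  refine mul_le_mul_of_nonneg_left ?_ (abs_nonneg _)
  calc |x i| ≤ ‖x‖ := norm_le_pi_norm x i
    _ ≤ K * N x := hK x
    _ ≤ |K| * 1 := mul_le_mul (le_abs_self K) hx (apply_nonneg _ _) (abs_nonneg _)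
    _ = |K| := mul_one _

theorem dualNorm_nonneg (hN : ∀ x, N x = 0 → x = 0) (z : Fin q → ℝ) : 0 ≤ dualNorm N z :=
  le_csSup (bddAbove_dualNorm hN z) ⟨0, by simp, by simp⟩

theorem dotProduct_le_dualNorm_mul (hN : ∀ x, N x = 0 → x = 0) (z x : Fin q → ℝ) :
    z ⬝ᵥ x ≤ dualNorm N z * N x := by
  rcases (apply_nonneg N x).eq_or_lt with h0 | hpos
  · simp [hN x h0.symm]
  · have h1 : z ⬝ᵥ ((N x)⁻¹ • x) ≤ dualNorm N z := by
      refine le_csSup (bddAbove_dualNorm hN z) ⟨_, ?_, rfl⟩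
      simp [map_smul_eq_mul, abs_of_pos hpos, hpos.ne']
    rwa [dotProduct_smul, smul_eq_mul, inv_mul_eq_div, div_le_iff₀ hpos] at h1

theorem dualNorm_le_of_forall {z : Fin q → ℝ} {c : ℝ} (hc : 0 ≤ c)
    (h : ∀ x, z ⬝ᵥ x ≤ c * N x) : dualNorm N z ≤ c := by
  refine csSup_le ⟨_, 0, by simp, rfl⟩ ?_
  rintro _ ⟨x, hx, rfl⟩
  exact (h x).trans (mul_le_of_le_one_right hc hx)

end DualNorm

/-! ### Block decomposition and weighted block norms -/

section Blocks

variable {n : ℕ} (d : Fin n → ℕ)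

/-- `blockProj` as a linear map. -/
def blockProjLinear (k : Fin n) : (Fin (∑ k, d k) → ℝ) →ₗ[ℝ] (Fin (d k) → ℝ) where
  toFun := blockProj d k
  map_add' _ _ := rfl
  map_smul' _ _ := rfl

variable {d}

theorem blockProj_sub (k : Fin n) (x y : Fin (∑ k, d k) → ℝ) :
    blockProj d k (x - y) = blockProj d k x - blockProj d k y :=
  rfl

theorem dotProduct_eq_sum_blockProj (z x : Fin (∑ k, d k) → ℝ) :
    z ⬝ᵥ x = ∑ k, blockProj d k z ⬝ᵥ blockProj d k x := by
  simp only [dotProduct, blockProj]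
  rw [← Equiv.sum_comp finSigmaFinEquiv, Fintype.sum_sigma]

theorem exists_blockProj_eq (Y : ∀ k, Fin (d k) → ℝ) :
    ∃ x : Fin (∑ k, d k) → ℝ, ∀ k, blockProj d k x = Y k :=
  ⟨fun t => Y _ (finSigmaFinEquiv.symm t).2, fun k => by
    ext i
    simp only [blockProj]
    rw [Equiv.symm_apply_apply]⟩

variable (N : ∀ k, Seminorm ℝ (Fin (d k) → ℝ))

theorem dotProduct_le_sum_mul (hN : ∀ k x, N k x = 0 → x = 0) {z : Fin (∑ k, d k) → ℝ}
    {lam : Fin n → ℝ} (hz : ∀ k, dualNorm (N k) (blockProj d k z) ≤ lam k)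
    (x : Fin (∑ k, d k) → ℝ) : z ⬝ᵥ x ≤ ∑ k, lam k * N k (blockProj d k x) := by
  rw [dotProduct_eq_sum_blockProj]
  exact Finset.sum_le_sum fun k _ => (dotProduct_le_dualNorm_mul (hN k) _ _).trans
    (mul_le_mul_of_nonneg_right (hz k) (apply_nonneg _ _))

/-- The weighted sum of the block norms. -/
def weightedSeminorm {lam : Fin n → ℝ} (hlam : 0 ≤ lam) : Seminorm ℝ (Fin (∑ k, d k) → ℝ) :=
  Seminorm.of (fun y => ∑ k, lam k * N k (blockProj d k y))
    (fun x y => by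
      rw [← Finset.sum_add_distrib]
      refine Finset.sum_le_sum fun k _ => ?_
      rw [← mul_add]
      exact mul_le_mul_of_nonneg_left (map_add_le_add (N k) _ _) (hlam k))
    (fun a x => by
      rw [Finset.mul_sum]
      refine Finset.sum_congr rfl fun k _ => ?_
      have : blockProj d k (a • x) = a • blockProj d k x := rfl
      rw [this, map_smul_eq_mul]
      ring)

theorem weightedSeminorm_apply {lam : Fin n → ℝ} (hlam : 0 ≤ lam) (y : Fin (∑ k, d k) → ℝ) :
    weightedSeminorm N hlam y = ∑ k, lam k * N k (blockProj d k y) :=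
  rfl

variable (d) in
/-- The displacements whose blocks vanish wherever `ε` does. -/
def frozenBlocks (ε : Fin n → ℝ) : Submodule ℝ (Fin (∑ k, d k) → ℝ) :=
  ⨅ (k) (_ : ε k = 0), LinearMap.ker (blockProjLinear d k)

theorem mem_frozenBlocks {ε : Fin n → ℝ} {y : Fin (∑ k, d k) → ℝ} :
    y ∈ frozenBlocks d ε ↔ ∀ k, ε k = 0 → blockProj d k y = 0 := by
  simp only [frozenBlocks, Submodule.mem_iInf, LinearMap.mem_ker]
  rfl

/-- A displacement supported in the single block `k` lies in the subspace as soon as `ε k ≠ 0`, and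
testing on it isolates that block. -/
theorem dualNorm_blockProj_le_of_frozenBlocks {lam : Fin n → ℝ} (hlam : 0 ≤ lam)
    {ε : Fin n → ℝ} {z : Fin (∑ k, d k) → ℝ}
    (h : ∀ y ∈ frozenBlocks d ε, z ⬝ᵥ y ≤ weightedSeminorm N hlam y) {k : Fin n}
    (hk : ε k ≠ 0) : dualNorm (N k) (blockProj d k z) ≤ lam k := by
  refine dualNorm_le_of_forall (hlam k) fun x => ?_
  obtain ⟨y, hy⟩ := exists_blockProj_eq (d := d) (Pi.single k x)
  have h1 := h y (mem_frozenBlocks.2 fun i hi => by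
    rw [hy, Pi.single_eq_of_ne]
    rintro rfl
    exact hk hi)
  rw [dotProduct_eq_sum_blockProj, weightedSeminorm_apply,
    Finset.sum_eq_single k (fun i _ hi => by rw [hy, Pi.single_eq_of_ne hi, dotProduct_zero])
      (by simp),
    Finset.sum_eq_single k (fun i _ hi => by rw [hy, Pi.single_eq_of_ne hi, map_zero, mul_zero])
      (by simp), hy, Pi.single_eq_same] at h1
  exact h1

end Blocks

/-! ### Dual multipliers on a polyhedron -/

section Polyhedron

variable {n r : ℕ} {d : Fin n → ℕ} (N : ∀ k, Seminorm ℝ (Fin (d k) → ℝ))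
  {C : Matrix (Fin r) (Fin (∑ k, d k)) ℝ} {f : Fin r → ℝ}

/-- A feasible dual point dominates an affine function on the polyhedron. -/
theorem affine_le_of_dual_feasible (hN : ∀ k x, N k x = 0 → x = 0) {γ : Fin r → ℝ} (hγ : 0 ≤ γ)
    {α ξ x : Fin (∑ k, d k) → ℝ} (hx : x ∈ polyhedron C f) {β s : ℝ} {lam : Fin n → ℝ}
    (hs : β + α ⬝ᵥ ξ + γ ⬝ᵥ (f - C *ᵥ ξ) ≤ s)
    (hz : ∀ k, dualNorm (N k) (blockProj d k (Cᵀ *ᵥ γ - α)) ≤ lam k) :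
    β + α ⬝ᵥ x ≤ s + ∑ k, lam k * N k (blockProj d k ξ - blockProj d k x) := by
  -- Pairing `Cᵀγ - α` with `ξ - x` bounds the change of the affine function up to a change in
  -- constraint slack; `γ ≥ 0` gives the sign of the slack at `x`.
  have h1 := dotProduct_le_sum_mul N hN hz (ξ - x)
  have h2 : 0 ≤ γ ⬝ᵥ (f - C *ᵥ x) := dotProduct_nonneg_of_nonneg hγ (sub_nonneg.2 hx)
  simp only [blockProj_sub, sub_dotProduct, dotProduct_sub, mulVec_transpose,
    ← dotProduct_mulVec] at h1 h2 hs
  linarith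

/-- Multipliers for a lower envelope of affine functions on a polyhedron. -/
theorem exists_multipliers_of_min_le {m : ℕ} (hm : 0 < m)
    {A : Matrix (Fin m) (Fin (∑ k, d k)) ℝ} {b : Fin m → ℝ} {ξ : Fin (∑ k, d k) → ℝ}
    (hξ : ξ ∈ polyhedron C f) {lam : Fin n → ℝ} (hlam : 0 ≤ lam) {ε : Fin n → ℝ} {s : ℝ}
    (h : ∀ x ∈ polyhedron C f, (∀ k, ε k = 0 → blockProj d k ξ = blockProj d k x) →
      ∃ j, A j ⬝ᵥ x + b j ≤ s + ∑ k, lam k * N k (blockProj d k ξ - blockProj d k x)) :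
    ∃ (γ : Fin r → ℝ) (θ : Fin m → ℝ), 0 ≤ γ ∧ 0 ≤ θ ∧ θ ⬝ᵥ 1 = 1 ∧
      θ ⬝ᵥ (b + A *ᵥ ξ) + γ ⬝ᵥ (f - C *ᵥ ξ) ≤ s ∧
      ∀ k, ε k ≠ 0 → dualNorm (N k) (blockProj d k (Cᵀ *ᵥ γ - Aᵀ *ᵥ θ)) ≤ lam k := by
  -- Hypograph form: over displacements `y` in `U` and levels `t`, maximise `t` minus the weighted
  -- norm of `y`, subject to `ξ + y` in the polyhedron and `t` below every affine piece.
  let U := frozenBlocks d ε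
  let pr : (U × ℝ) →ₗ[ℝ] (Fin (∑ k, d k) → ℝ) := U.subtype.comp (LinearMap.fst ℝ U ℝ)
  let c : Fin (r + m) → (U × ℝ) →ₗ[ℝ] ℝ :=
    Fin.append (fun i => ((LinearMap.proj i).comp C.mulVecLin).comp pr)
      (fun j => LinearMap.snd ℝ U ℝ - ((LinearMap.proj j).comp A.mulVecLin).comp pr)
  let g : Fin (r + m) → ℝ := Fin.append (f - C *ᵥ ξ) (b + A *ᵥ ξ)
  have hc : ∀ w : U × ℝ, (∀ i, c i w ≤ g i) ↔
      (C *ᵥ w.1 ≤ f - C *ᵥ ξ) ∧ ∀ j, w.2 - (A *ᵥ w.1) j ≤ b j + (A *ᵥ ξ) j := fun w => by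
    constructor
    · intro hw
      exact ⟨fun i => by simpa [c, g, pr] using hw (Fin.castAdd m i),
        fun j => by simpa [c, g, pr] using hw (Fin.natAdd r j)⟩
    · rintro ⟨h1, h2⟩ i
      refine Fin.addCases (fun i => ?_) (fun j => ?_) i
      · simpa [c, g, pr] using h1 i
      · simpa [c, g, pr] using h2 j
  have : Nonempty (Fin m) := ⟨⟨0, hm⟩⟩
  obtain ⟨μ, hμ, hle, hσ⟩ := exists_nonneg_sub_sum_le_seminorm
    ((weightedSeminorm N hlam).comp pr) c g (LinearMap.snd ℝ U ℝ) s
    ⟨(0, ⨅ j, (b j + (A *ᵥ ξ) j)), (hc _).2 ⟨by simpa using show C *ᵥ ξ ≤ f from hξ, fun j => by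
      simpa using ciInf_le (Set.finite_range fun j => b j + (A *ᵥ ξ) j).bddBelow j⟩⟩
    (fun w hw => by
      obtain ⟨h1, h2⟩ := (hc w).1 hw
      obtain ⟨j, hj⟩ := h (ξ + w.1) (by
        change C *ᵥ (ξ + w.1) ≤ f
        rw [mulVec_add]
        exact add_le_of_le_sub_left h1) (fun k hk => by
          have := mem_frozenBlocks.1 w.1.2 k hk
          rw [← sub_eq_zero, ← blockProj_sub, sub_add_cancel_left]
          change -blockProj d k w.1 = 0
          rw [this, neg_zero])
      have h3 := h2 j
      have h4 : ∀ k, N k (blockProj d k ξ - blockProj d k (ξ + w.1)) =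
          N k (blockProj d k w.1) := fun k => by
        rw [← blockProj_sub, sub_add_cancel_left]
        exact map_neg_eq_map (N k) _
      simp only [h4, dotProduct_add] at hj
      simp only [mulVec] at h3
      change w.2 - ∑ k, lam k * N k (blockProj d k w.1) ≤ s
      linarith)
  refine ⟨fun i => μ (Fin.castAdd m i), fun j => μ (Fin.natAdd r j), fun i => hμ _,
    fun j => hμ _, ?_, ?_, ?_⟩
  -- The seminorm ignores the level variable, so testing with levels `1` and `-1` forces the weights
  -- to sum to one.
  · have h1 := hle (0, 1)
    have h2 := hle (0, -1)
    simp [Fin.sum_univ_add, c, pr] at h1 h2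
    simp [dotProduct]
    linarith
  · simpa [Fin.sum_univ_add, g, dotProduct, add_comm] using hσ
  · intro k hk
    refine dualNorm_blockProj_le_of_frozenBlocks N hlam (ε := ε) (fun y hy => ?_) hk
    have h1 := hle (-⟨y, hy⟩, 0)
    simp [Fin.sum_univ_add, c, pr, mulVec_neg] at h1
    rw [sub_dotProduct, mulVec_transpose, mulVec_transpose, ← dotProduct_mulVec,
      ← dotProduct_mulVec]
    simp only [dotProduct]
    linarith

end Polyhedron

/-! ### Lipschitz bounds for the objectives and the finite programs -/

theorem abs_ciSup_sub_ciSup_le {m : ℕ} (hm : 0 < m) {u v : Fin m → ℝ} {c : ℝ}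
    (h : ∀ j, |u j - v j| ≤ c) : |(⨆ j, u j) - ⨆ j, v j| ≤ c := by
  have : Nonempty (Fin m) := ⟨⟨0, hm⟩⟩
  have key : ∀ {u v : Fin m → ℝ}, (∀ j, |u j - v j| ≤ c) → (⨆ j, u j) ≤ c + ⨆ j, v j :=
    fun {u v} h => ciSup_le fun j => by
      linarith [le_abs_self (u j - v j), h j, le_ciSup (Set.finite_range v).bddAbove j]
  rw [abs_sub_le_iff]
  constructor
  · linarith [key h]
  · linarith [key fun j => (abs_sub_comm (v j) (u j)).trans_le (h j)]

theorem abs_ciInf_sub_ciInf_le {m : ℕ} (hm : 0 < m) {u v : Fin m → ℝ} {c : ℝ}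
    (h : ∀ j, |u j - v j| ≤ c) : |(⨅ j, u j) - ⨅ j, v j| ≤ c := by
  have : Nonempty (Fin m) := ⟨⟨0, hm⟩⟩
  have key : ∀ {u v : Fin m → ℝ}, (∀ j, |u j - v j| ≤ c) → (⨅ j, u j) - c ≤ ⨅ j, v j :=
    fun {u v} h => le_ciInf fun j => by
      linarith [le_abs_self (u j - v j), h j, ciInf_le (Set.finite_range u).bddBelow j]
  rw [abs_sub_le_iff]
  constructor
  · linarith [key h]
  · linarith [key fun j => (abs_sub_comm (v j) (u j)).trans_le (h j)]

section Programs

variable {n r m M : ℕ} {d : Fin n → ℕ} {N : ∀ k, Seminorm ℝ (Fin (d k) → ℝ)}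
  {C : Matrix (Fin r) (Fin (∑ k, d k)) ℝ} {f : Fin r → ℝ}
  {A : Matrix (Fin m) (Fin (∑ k, d k)) ℝ} {b : Fin m → ℝ}
  {ϑ : Fin M → ℝ} {ξ : Fin M → polyhedron C f} {ε : Fin n → ℝ}

theorem measurable_affine (α : Fin (∑ k, d k) → ℝ) (β : ℝ) :
    Measurable fun x : polyhedron C f => α ⬝ᵥ (x : Fin (∑ k, d k) → ℝ) + β := by
  refine Continuous.measurable (Continuous.add (continuous_finsetSum _ fun i _ => ?_)
    continuous_const)
  exact continuous_const.mul ((continuous_apply i).comp continuous_subtype_val)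

/-- Summing the dual norms over all pieces gives constants independent of `j`, so the bound passes
to maxima and minima. -/
theorem abs_affine_sub_affine_le (hN : ∀ k x, N k x = 0 → x = 0) (b : Fin m → ℝ) (j : Fin m)
    (x y : polyhedron C f) :
    |(A j ⬝ᵥ (y : Fin (∑ k, d k) → ℝ) + b j) - (A j ⬝ᵥ (x : Fin (∑ k, d k) → ℝ) + b j)| ≤
      ∑ k, (∑ j, dualNorm (N k) (blockProj d k (A j))) * blockDist N (polyhedron C f) k x y := by
  have hz : ∀ k, dualNorm (N k) (blockProj d k (A j)) ≤
      ∑ j, dualNorm (N k) (blockProj d k (A j)) := fun k =>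
    Finset.single_le_sum (f := fun j => dualNorm (N k) (blockProj d k (A j)))
      (fun i _ => dualNorm_nonneg (hN k) _) (Finset.mem_univ j)
  have h1 := dotProduct_le_sum_mul N hN hz (x - y : Fin (∑ k, d k) → ℝ)
  have h2 := dotProduct_le_sum_mul N hN hz (y - x : Fin (∑ k, d k) → ℝ)
  simp only [blockProj_sub, dotProduct_sub] at h1 h2
  have h3 : ∀ k, N k (blockProj d k y - blockProj d k x) =
      blockDist N (polyhedron C f) k x y := fun k => map_sub_rev (N k) _ _
  simp only [h3] at h2
  rw [add_sub_add_right_eq_sub, abs_sub_le_iff]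
  exact ⟨h2, h1⟩

theorem isTransportLipschitz_blockDist (hN : ∀ k x, N k x = 0 → x = 0) (b : Fin m → ℝ)
    {h : polyhedron C f → ℝ} (hmeas : Measurable h)
    (hlip : ∀ (x y : polyhedron C f) (c : ℝ), (∀ j, |(A j ⬝ᵥ (y : Fin (∑ k, d k) → ℝ) + b j) -
      (A j ⬝ᵥ (x : Fin (∑ k, d k) → ℝ) + b j)| ≤ c) → |h y - h x| ≤ c) :
    IsTransportLipschitz (blockDist N (polyhedron C f)) h
      (fun k => ∑ j, dualNorm (N k) (blockProj d k (A j))) where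
  measurable_cost k := by
    refine Continuous.measurable ((N k).continuous_of_finiteDimensional.comp ?_)
    exact continuous_pi fun i => (((continuous_apply _).comp continuous_subtype_val).comp
      continuous_fst).sub (((continuous_apply _).comp continuous_subtype_val).comp continuous_snd)
  cost_nonneg k x y := apply_nonneg _ _
  cost_self k x := by simp [blockDist]
  measurable := hmeas
  nonneg k := Finset.sum_nonneg fun j _ => dualNorm_nonneg (hN k) _
  lipschitz x y := hlip x y _ fun j => abs_affine_sub_affine_le hN b j x y

/-- Every atom can be assigned an atom of positive mass, the atoms of positive mass being
assigned to themselves. -/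
theorem exists_positive_atom (hϑ1 : ∑ l, ϑ l = 1) :
    ∃ e : Fin M → Fin M, ∀ l, 0 < ϑ (e l) ∧ (0 < ϑ l → e l = l) := by
  obtain ⟨l₀, hl₀⟩ : ∃ l, 0 < ϑ l := by
    by_contra! hle
    have := Finset.sum_nonpos fun l (_ : l ∈ Finset.univ) => hle l
    linarith
  have : ∀ l, ∃ l', 0 < ϑ l' ∧ (0 < ϑ l → l' = l) := fun l => by
    by_cases hl : 0 < ϑ l
    · exact ⟨l, hl, fun _ => rfl⟩
    · exact ⟨l₀, hl₀, fun h => absurd h hl⟩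
  choose e he using this
  exact ⟨e, he⟩

theorem maxProgram_duality (hm : 0 < m) (hN : ∀ k x, N k x = 0 → x = 0)
    (hϑ : ∀ l, 0 ≤ ϑ l) (hϑ1 : ∑ l, ϑ l = 1) (hε : ∀ k, 0 ≤ ε k)
    {h : polyhedron C f → ℝ}
    (h_def : ∀ x, h x = ⨆ j, (A j ⬝ᵥ (x : Fin (∑ k, d k) → ℝ) + b j))
    {L : Fin n → ℝ} (H : IsTransportLipschitz (blockDist N (polyhedron C f)) h L) :
    ∃ v : ℝ, IsLUB (expectations (multiTransportHyperrectangle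
        (blockDist N (polyhedron C f)) 1 (discreteMeasure ϑ ξ) ε) h) v ∧
      IsGLB (maxProgramValues N C f A b ϑ (fun l => (ξ l : Fin (∑ k, d k) → ℝ)) ε) v := by
  have : Nonempty (Fin m) := ⟨⟨0, hm⟩⟩
  -- An atom and a piece must exist for the dual-norm constraints to force the multipliers of a
  -- feasible point to be nonnegative, which the program does not require.
  have hM : 0 < M := Nat.pos_of_ne_zero fun h0 => by
    subst h0
    simp at hϑ1
  obtain ⟨e, he⟩ := exists_positive_atom hϑ1
  obtain ⟨v, hv, lam, hlam, s, hsv, hs⟩ := H.exists_isLUB (ξ := ξ) hϑ hϑ1 hε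
  refine ⟨v, hv, ?_, fun u hu => ?_⟩
  · rintro _ ⟨lam', s', γ, h1, h2, h3, rfl⟩
    refine hv.2 ?_
    rintro _ ⟨P, hP, rfl⟩
    refine H.integral_le hϑ hε (fun k => ?_) (fun l x => ?_) hP
    · exact (dualNorm_nonneg (hN k) _).trans (h2 ⟨0, hM⟩ ⟨0, hm⟩ k)
    · rw [h_def]
      refine ciSup_le fun j => ?_
      rw [add_comm]
      exact affine_le_of_dual_feasible N hN (h3 l j) x.2 (h1 l j) (h2 l j)
  · have hmul : ∀ l j, ∃ γ : Fin r → ℝ, 0 ≤ γ ∧ (0 < ϑ l →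
        b j + A j ⬝ᵥ (ξ l : Fin (∑ k, d k) → ℝ) + γ ⬝ᵥ (f - C *ᵥ ξ l) ≤ s l ∧
        ∀ k, ε k ≠ 0 → dualNorm (N k) (blockProj d k (Cᵀ *ᵥ γ - A j)) ≤ lam k) := fun l j => by
      by_cases hl : 0 < ϑ l
      swap
      · exact ⟨0, le_rfl, fun h => absurd h hl⟩
      -- Each piece lies below the maximum, so the lower-envelope result applies to it alone, with
      -- the single weight `θ 0 = 1`.
      obtain ⟨γ, θ, hγ, -, hθ1, h1, h2⟩ := exists_multipliers_of_min_le N one_pos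
        (A := fun _ => A j) (b := fun _ => b j) (ξ l).2 hlam (ε := ε) (s := s l)
        fun x hx hxk => ⟨0, by
          refine le_trans ?_ (hs l hl ⟨x, hx⟩ fun k hk => ?_)
          · rw [h_def]
            exact le_ciSup (f := fun j => A j ⬝ᵥ x + b j) (Set.finite_range _).bddAbove j
          · simp [blockDist, hxk k hk]⟩
      have hθ : θ 0 = 1 := by simpa [dotProduct] using hθ1
      refine ⟨γ, hγ, fun _ => ⟨?_, fun k hk => ?_⟩⟩
      · simpa [dotProduct, hθ, mulVec] using h1
      · convert h2 k hk using 3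
        ext i
        simp [mulVec, dotProduct, hθ]
        rfl
    choose γ hγ0 hγ using hmul
    -- Massless atoms borrow `γ` from an atom of positive mass, keeping the dual-norm bounds for `ε
    -- k ≠ 0`; their `s'` is raised until the constraints hold, at no cost.
    let s' : Fin M → ℝ := fun l => if 0 < ϑ l then s l else
      ⨆ j, (b j + A j ⬝ᵥ (ξ l : Fin (∑ k, d k) → ℝ) + γ (e l) j ⬝ᵥ (f - C *ᵥ ξ l))
    let B : Fin n → Fin M → Fin m → ℝ := fun k l j =>
      dualNorm (N k) (blockProj d k (Cᵀ *ᵥ γ (e l) j - A j))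
    -- Where `ε k = 0` the multiplier does not affect the objective, so it may exceed all the dual
    -- norms it must bound.
    let lam' : Fin n → ℝ := fun k => if ε k = 0 then ∑ l, ∑ j, B k l j else lam k
    have hB : ∀ k l j, 0 ≤ B k l j := fun k l j => dualNorm_nonneg (hN k) _
    refine (hu ⟨lam', s', fun l j => γ (e l) j, fun l j => ?_, fun l j k => ?_,
      fun l j => hγ0 _ _, rfl⟩).trans (Eq.trans_le ?_ hsv)
    · by_cases hl : 0 < ϑ l
      · simp only [s', if_pos hl, (he l).2 hl]
        exact (hγ l j hl).1
      · simp only [s', if_neg hl]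
        exact le_ciSup (f := fun j => b j + A j ⬝ᵥ (ξ l : Fin (∑ k, d k) → ℝ) +
          γ (e l) j ⬝ᵥ (f - C *ᵥ ξ l)) (Set.finite_range _).bddAbove j
    · by_cases hk : ε k = 0
      · simp only [lam', if_pos hk]
        exact (Finset.single_le_sum (fun i _ => hB k l i) (Finset.mem_univ j)).trans
          (Finset.single_le_sum (f := fun l => ∑ j, B k l j)
            (fun i _ => Finset.sum_nonneg fun j _ => hB k i j) (Finset.mem_univ l))
      · simp only [lam', if_neg hk]
        exact (hγ (e l) j (he l).1).2 k hk
    · congr 1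
      · refine Finset.sum_congr rfl fun k _ => ?_
        by_cases hk : ε k = 0 <;> simp [lam', hk]
      · refine Finset.sum_congr rfl fun l _ => ?_
        rcases (hϑ l).eq_or_lt with hl | hl
        · simp [← hl]
        · simp [s', hl]

theorem minProgram_duality (hm : 0 < m) (hN : ∀ k x, N k x = 0 → x = 0)
    (hϑ : ∀ l, 0 ≤ ϑ l) (hϑ1 : ∑ l, ϑ l = 1) (hε : ∀ k, 0 ≤ ε k)
    {h : polyhedron C f → ℝ}
    (h_def : ∀ x, h x = ⨅ j, (A j ⬝ᵥ (x : Fin (∑ k, d k) → ℝ) + b j))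
    {L : Fin n → ℝ} (H : IsTransportLipschitz (blockDist N (polyhedron C f)) h L) :
    ∃ v : ℝ, IsLUB (expectations (multiTransportHyperrectangle
        (blockDist N (polyhedron C f)) 1 (discreteMeasure ϑ ξ) ε) h) v ∧
      IsGLB (minProgramValues N C f A b ϑ (fun l => (ξ l : Fin (∑ k, d k) → ℝ)) ε) v := by
  have : Nonempty (Fin m) := ⟨⟨0, hm⟩⟩
  have hM : 0 < M := Nat.pos_of_ne_zero fun h0 => by
    subst h0
    simp at hϑ1
  obtain ⟨e, he⟩ := exists_positive_atom hϑ1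
  obtain ⟨v, hv, lam, hlam, s, hsv, hs⟩ := H.exists_isLUB (ξ := ξ) hϑ hϑ1 hε
  refine ⟨v, hv, ?_, fun u hu => ?_⟩
  · rintro _ ⟨lam', s', γ, θ, h1, h2, h3, h4, h5, rfl⟩
    refine hv.2 ?_
    rintro _ ⟨P, hP, rfl⟩
    refine H.integral_le hϑ hε (fun k => ?_) (fun l x => ?_) hP
    · exact (dualNorm_nonneg (hN k) _).trans (h2 ⟨0, hM⟩ k)
    · have h6 := affine_le_of_dual_feasible N hN (h4 l) x.2 (β := θ l ⬝ᵥ b)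
        (α := Aᵀ *ᵥ θ l) (s := s' l) (by
          rw [mulVec_transpose, ← dotProduct_mulVec, ← dotProduct_add]
          exact h1 l) (h2 l)
      refine le_trans ?_ h6
      rw [mulVec_transpose, ← dotProduct_mulVec, ← dotProduct_add]
      -- The minimum is at most any convex combination of the pieces.
      calc h x = θ l ⬝ᵥ fun _ => h x := by
            have h7 : (fun _ : Fin m => h x) = h x • (1 : Fin m → ℝ) := by
              ext
              simp
            rw [h7, dotProduct_smul, h3 l, smul_eq_mul, mul_one]
        _ ≤ _ := dotProduct_le_dotProduct_of_nonneg_left (fun j => by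
            rw [h_def, Pi.add_apply, add_comm]
            exact ciInf_le (f := fun j => A j ⬝ᵥ (x : Fin (∑ k, d k) → ℝ) + b j)
              (Set.finite_range _).bddBelow j) (h5 l)
  · have hmul : ∀ l, 0 < ϑ l → ∃ (γ : Fin r → ℝ) (θ : Fin m → ℝ), 0 ≤ γ ∧ 0 ≤ θ ∧
        θ ⬝ᵥ 1 = 1 ∧
        θ ⬝ᵥ (b + A *ᵥ (ξ l : Fin (∑ k, d k) → ℝ)) + γ ⬝ᵥ (f - C *ᵥ ξ l) ≤ s l ∧
        ∀ k, ε k ≠ 0 → dualNorm (N k) (blockProj d k (Cᵀ *ᵥ γ - Aᵀ *ᵥ θ)) ≤ lam k :=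
      fun l hl => exists_multipliers_of_min_le N hm (ξ l).2 hlam fun x hx hxk => by
        obtain ⟨j, hj⟩ := exists_eq_ciInf_of_finite (f := fun j => A j ⬝ᵥ x + b j)
        refine ⟨j, ?_⟩
        rw [hj, ← h_def ⟨x, hx⟩]
        exact hs l hl ⟨x, hx⟩ fun k hk => by simp [blockDist, hxk k hk]
    choose γ θ hγ0 hθ0 hθ1 hle hdual using fun l => hmul (e l) (he l).1
    -- The same free repairs as for the maximum: `s'` at massless atoms, `lam'` at vanishing
    -- budgets.
    let s' : Fin M → ℝ := fun l => if 0 < ϑ l then s l else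
      θ l ⬝ᵥ (b + A *ᵥ (ξ l : Fin (∑ k, d k) → ℝ)) + γ l ⬝ᵥ (f - C *ᵥ ξ l)
    let B : Fin n → Fin M → ℝ := fun k l =>
      dualNorm (N k) (blockProj d k (Cᵀ *ᵥ γ l - Aᵀ *ᵥ θ l))
    let lam' : Fin n → ℝ := fun k => if ε k = 0 then ∑ l, B k l else lam k
    refine (hu ⟨lam', s', γ, θ, fun l => ?_, fun l k => ?_, hθ1, hγ0, hθ0,
      rfl⟩).trans (Eq.trans_le ?_ hsv)
    · by_cases hl : 0 < ϑ l
      · have := hle l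
        rw [(he l).2 hl] at this
        simpa only [s', if_pos hl] using this
      · simp only [s', if_neg hl, le_refl]
    · by_cases hk : ε k = 0
      · simp only [lam', if_pos hk]
        exact Finset.single_le_sum (f := fun l => B k l)
          (fun i _ => dualNorm_nonneg (hN k) _) (Finset.mem_univ l)
      · simp only [lam', if_neg hk]
        exact hdual l k hk
    · congr 1
      · refine Finset.sum_congr rfl fun k _ => ?_
        by_cases hk : ε k = 0 <;> simp [lam', hk]
      · refine Finset.sum_congr rfl fun l _ => ?_
        rcases (hϑ l).eq_or_lt with hl | hl
        · simp [← hl]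
        · simp [s', hl]

end Programs

end

theorem mainTheorem5 {n r m M : ℕ} (d : Fin n → ℕ) (hm : 0 < m)
    (N : ∀ k, Seminorm ℝ (Fin (d k) → ℝ)) (hN : ∀ k x, N k x = 0 → x = 0)
    (C : Matrix (Fin r) (Fin (∑ k, d k)) ℝ) (f : Fin r → ℝ)
    (A : Matrix (Fin m) (Fin (∑ k, d k)) ℝ) (b : Fin m → ℝ)
    (ϑ : Fin M → ℝ) (hϑ : ∀ l, 0 ≤ ϑ l) (hϑ1 : ∑ l, ϑ l = 1)
    (ξ : Fin M → polyhedron C f) (ε : Fin n → ℝ) (hε : ∀ k, 0 ≤ ε k)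
    (T : Set (Measure (polyhedron C f)))
    (hT : T = multiTransportHyperrectangle (blockDist N (polyhedron C f)) 1
      (discreteMeasure ϑ ξ) ε)
    (hmax hmin : polyhedron C f → ℝ)
    (hmax_def : ∀ x, hmax x = ⨆ j, (A j ⬝ᵥ (x : Fin (∑ k, d k) → ℝ) + b j))
    (hmin_def : ∀ x, hmin x = ⨅ j, (A j ⬝ᵥ (x : Fin (∑ k, d k) → ℝ) + b j)) :
    ((∀ P ∈ T, Integrable hmax P) ∧
      ∃ v : ℝ, IsLUB (expectations T hmax) v ∧
        IsGLB (maxProgramValues N C f A b ϑ (fun l => (ξ l : Fin (∑ k, d k) → ℝ)) ε) v) ∧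
    ((∀ P ∈ T, Integrable hmin P) ∧
      ∃ v : ℝ, IsLUB (expectations T hmin) v ∧
        IsGLB (minProgramValues N C f A b ϑ (fun l => (ξ l : Fin (∑ k, d k) → ℝ)) ε) v) := by
  subst hT
  have H1 := isTransportLipschitz_blockDist (A := A) hN b (h := hmax)
    (by
      rw [funext hmax_def]
      exact Measurable.iSup fun j => measurable_affine (A j) (b j))
    (fun x y c h => by
      rw [hmax_def, hmax_def]
      exact abs_ciSup_sub_ciSup_le hm h)
  have H2 := isTransportLipschitz_blockDist (A := A) hN b (h := hmin)
    (by
      rw [funext hmin_def]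
      exact Measurable.iInf fun j => measurable_affine (A j) (b j))
    (fun x y c h => by
      rw [hmin_def, hmin_def]
      exact abs_ciInf_sub_ciInf_le hm h)
  exact ⟨⟨fun P hP => H1.integrable_of_mem hP,
      maxProgram_duality hm hN hϑ hϑ1 hε hmax_def H1⟩,
    ⟨fun P hP => H2.integrable_of_mem hP,
      minProgram_duality hm hN hϑ hϑ1 hε hmin_def H2⟩⟩
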